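/- Let $0<p<\tfrac12$. Write $|J|$ for arc length on the unit circle $\partial\mathbb D$ (total length $2\pi$). For real $\alpha$, an $\alpha$-Beurling--Carleson set is a closed set $E\subset\partial\mathbb D$ of zero length whose complementary arcs $\{J\}$ (the connected components of $\partial\mathbb D\setminus E$) satisfy $\sum_J|J|^{\alpha}<\infty$. For a finite positive measure $\mu$ on $\partial\mathbb D$ put $$S_\mu(z)=\exp\Bigl(-\int_{\partial\mathbb D}\frac{\zeta+z}{\zeta-z}\,d\mu(\zeta)\Bigr),\qquad |z|<1,$$ and let $H^p$ be the space of analytic functions $f$ on the unit disk with $\sup_{0\le r<1}\int_{-\pi}^{\pi}|f(re^{i\theta})|^p\,d\theta<\infty$. For $A>2$, let $E_A\subset\partial\mathbb D$ be the standard Cantor set: start with the arc $\{e^{it}:0\le t\le 1\}$ of length $1$ and replace repeatedly each arc of generation $n$, of length $A^{-n}$, by its two end pieces of length $A^{-n-1}$; $E_A$ is the intersection over $n$ of the unions of the $2^n$ closed arcs of generation $n$. The Cantor measure on $E_A$ is the probability measure supported on $E_A$ that gives mass $2^{-n}$ to each arc of generation $n$. Then: (a) For every real $q<\frac{p}{1-p}$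 there is an $A>2$ such that $E=E_A$ is a $(1-q)$-Beurling--Carleson set and, $\mu$ being the Cantor measure on $E$, one has $S_\nu'\notin H^p$ for every measure $\nu$ with $0<\nu\le\mu$ (i.e. $\nu\neq0$ and $\nu\le\mu$). (b) There is a finite positive singular measure $\mu$ on $\partial\mathbb D$ that is concentrated on a countable union of $(1-p)$-Beurling--Carleson sets but cannot be written as a countable sum $\mu=\sum_k\mu_k$ of finite positive measures $\mu_k$ with $S_{\mu_k}'\in H^p$ for all $k$. (c) If $q$ is a real number such that $S_\mu'\in H^p$ for every $(1-q)$-Beurling--Carleson set $E$ and every finite positive measure $\mu$ supported on $E$, then $q\ge\frac{p}{1-p}$. -/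

import Mathlib

open MeasureTheory Set
open scoped ENNReal NNReal

noncomputable section

instance instMeasurableSpaceCircle : MeasurableSpace Circle := borel Circle

instance instBorelSpaceCircle : BorelSpace Circle := ⟨rfl⟩

/-- Arc length on the unit circle (total mass `2 * π`). -/
def arcLength : Measure Circle :=
  (volume.restrict (Ioc (-Real.pi) Real.pi)).map Circle.exp

/-- The complementary arcs of a subset `E` of the unit circle: the connected components of the
complement of `E`. -/
def complementaryArcs (E : Set Circle) : Set (Set Circle) :=
  {J | ∃ z ∈ Eᶜ, J = connectedComponentIn Eᶜ z}

/-- `α`-Beurling--Carleson sets: closed sets of zero length whose complementary arcs `J` satisfy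
`∑ |J| ^ α < ∞`. -/
def IsBeurlingCarleson (α : ℝ) (E : Set Circle) : Prop :=
  IsClosed E ∧ arcLength E = 0 ∧ ∑' J : complementaryArcs E, arcLength (J : Set Circle) ^ α < ∞

/-- The singular inner function
`S_μ(z) = exp (- ∫ (ζ + z) / (ζ - z) dμ(ζ))` (only its values for `|z| < 1` matter). -/
def singularInner (μ : Measure Circle) (z : ℂ) : ℂ :=
  Complex.exp (-∫ ζ : Circle, ((ζ : ℂ) + z) / ((ζ : ℂ) - z) ∂μ)

/-- The Hardy space `H^p` of the unit disk: `f` is analytic for `|z| < 1` and the integrals of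
`|f| ^ p` over the circles `|z| = r`, `0 ≤ r < 1`, are uniformly bounded. -/
def MemHardy (p : ℝ) (f : ℂ → ℂ) : Prop :=
  DifferentiableOn ℂ f (Metric.ball 0 1) ∧
    ∃ C : ℝ≥0, ∀ r ∈ Ico (0 : ℝ) 1,
      ∫⁻ θ in Ioc (-Real.pi) Real.pi, ‖f (circleMap 0 r θ)‖ₑ ^ p ≤ C

/-- `S'_μ ∈ H^p`. -/
def DerivMemHardy (p : ℝ) (μ : Measure Circle) : Prop :=
  MemHardy p (deriv (singularInner μ))

/-- `μ` is concentrated on a countable union of `α`-Beurling--Carleson sets. -/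
def ConcentratedOnBeurlingCarleson (α : ℝ) (μ : Measure Circle) : Prop :=
  ∃ E : ℕ → Set Circle, (∀ k, IsBeurlingCarleson α (E k)) ∧ μ (⋃ k, E k)ᶜ = 0

/-- `μ` satisfies the property `P` up to countable sums: it is a countable sum of finite measures
satisfying `P`. -/
def UpToCountableSums (P : Measure Circle → Prop) (μ : Measure Circle) : Prop :=
  ∃ m : ℕ → Measure Circle, (∀ k, IsFiniteMeasure (m k) ∧ P (m k)) ∧ μ = Measure.sum m

/-- Left endpoint (as an angle) of the arc of generation `n` with address `w`; at step `k` one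
passes from an arc of length `A ^ (-k)` to its left (`false`) or right (`true`) end piece of
length `A ^ (-(k + 1))`. -/
def cantorLeft (A : ℝ) (n : ℕ) (w : Fin n → Bool) : ℝ :=
  ∑ k : Fin n, if w k then A⁻¹ ^ (k : ℕ) - A⁻¹ ^ ((k : ℕ) + 1) else 0

/-- The `2 ^ n` closed arcs of generation `n`, each of length `A ^ (-n)`. -/
def cantorArc (A : ℝ) (n : ℕ) (w : Fin n → Bool) : Set Circle :=
  Circle.exp '' Icc (cantorLeft A n w) (cantorLeft A n w + A⁻¹ ^ n)

/-- The standard Cantor set on the circle with parameter `A > 2`. -/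
def circleCantorSet (A : ℝ) : Set Circle :=
  ⋂ n : ℕ, ⋃ w : Fin n → Bool, cantorArc A n w

/-- `μ` is the standard Cantor measure on the Cantor set with parameter `A`: the probability
measure supported on it which gives equal mass to all the arcs of each generation. -/
def IsCantorMeasure (A : ℝ) (μ : Measure Circle) : Prop :=
  IsProbabilityMeasure μ ∧ μ (circleCantorSet A)ᶜ = 0 ∧
    ∀ (n : ℕ) (w : Fin n → Bool), μ (cantorArc A n w) = (2⁻¹ : ℝ≥0∞) ^ n

end

/-!
On the circle, off the support of a singular `ν`, `|S_ν'(z)| = ∫ 2 / |ζ - z| ^ 2 dν(ζ)`. So on the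
gap removed from a Cantor arc `I` of length `ℓ = A⁻ⁿ` one has `|S_ν'| ≥ 2 ν(I) / ℓ ^ 2`, and the
gap contributes at least a constant times `ℓ ^ (1 - 2 * p) * ν(I) ^ p` to `∫ |S_ν'| ^ p`. At the
critical ratio `A ^ (1 - 2 * p) = 2 ^ (1 - p)` the power of `ℓ` is `(2⁻ⁿ) ^ (1 - p)`, which is at
least `ν(I) ^ (1 - p)` when `ν` is below the Cantor measure. The gaps of each generation therefore
contribute at least a fixed multiple of the total mass of `ν`, the integral diverges, and Fatou's
lemma excludes `S_ν' ∈ H^p`. On the other hand, `E_A` is a `(1 - q)`-Beurling–Carleson set as soon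
as `2 < A ^ (1 - q)`, which at the critical ratio is the condition `q < p / (1 - p)`.
-/

noncomputable section

open scoped Real Topology

/-! ### Cantor intervals -/

section SuccessiveDifferences

variable {α : Type*} {s : ℕ → Set α}

lemma sdiff_iInter_eq_iUnion_sdiff_succ (hs : Antitone s) :
    s 0 \ ⋂ n, s n = ⋃ n, s n \ s (n + 1) := by
  ext t
  simp only [mem_sdiff, mem_iInter, mem_iUnion, not_forall]
  refine ⟨fun ⟨h0, hex⟩ => ?_, fun ⟨n, hn, hn'⟩ => ⟨hs (Nat.zero_le n) hn, n + 1, hn'⟩⟩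
  by_contra! hstep
  exact hex.elim fun n hn => hn (Nat.rec h0 hstep n)

lemma pairwise_disjoint_sdiff_succ (hs : Antitone s) :
    Pairwise (Function.onFun Disjoint fun n => s n \ s (n + 1)) := by
  refine (pairwise_disjoint_on _).2 fun m n hmn => disjoint_left.2 fun t htm htn => ?_
  exact htm.2 (hs hmn htn.1)

end SuccessiveDifferences

section CantorIntervals

variable {A : ℝ} {n : ℕ}

/-- The closed interval of angles that `Circle.exp` maps onto `cantorArc A n w`. -/
def cantorInterval (A : ℝ) (n : ℕ) (w : Fin n → Bool) : Set ℝ :=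
  Icc (cantorLeft A n w) (cantorLeft A n w + A⁻¹ ^ n)

/-- The open middle part of `cantorInterval A n w` that is removed at generation `n + 1`. -/
def cantorGap (A : ℝ) (n : ℕ) (w : Fin n → Bool) : Set ℝ :=
  Ioo (cantorLeft A n w + A⁻¹ ^ (n + 1)) (cantorLeft A n w + (A⁻¹ ^ n - A⁻¹ ^ (n + 1)))

/-- The union of the intervals of generation `n`. -/
def cantorLevel (A : ℝ) (n : ℕ) : Set ℝ :=
  ⋃ w, cantorInterval A n w

/-- The Cantor set of angles in `[0, 1]` that `Circle.exp` maps onto `circleCantorSet A`. -/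
def cantorAngles (A : ℝ) : Set ℝ :=
  ⋂ n, cantorLevel A n

lemma cantorArc_eq_image (A : ℝ) (n : ℕ) (w : Fin n → Bool) :
    cantorArc A n w = Circle.exp '' cantorInterval A n w := rfl

lemma inv_pow_succ_le (hA : 1 ≤ A) (n : ℕ) : A⁻¹ ^ (n + 1) ≤ A⁻¹ ^ n :=
  pow_le_pow_of_le_one (by positivity) (inv_le_one_of_one_le₀ hA) n.le_succ

lemma two_mul_inv_pow_succ_lt (hA : 2 < A) (n : ℕ) : 2 * A⁻¹ ^ (n + 1) < A⁻¹ ^ n := by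
  have hinv : A⁻¹ < 2⁻¹ := inv_strictAnti₀ two_pos hA
  have hpow : 0 < A⁻¹ ^ n := by positivity
  rw [pow_succ]
  nlinarith

lemma cantorLeft_snoc (A : ℝ) (w : Fin n → Bool) (b : Bool) :
    cantorLeft A (n + 1) (Fin.snoc w b) =
      cantorLeft A n w + if b then A⁻¹ ^ n - A⁻¹ ^ (n + 1) else 0 := by
  simp [cantorLeft, Fin.sum_univ_castSucc]

lemma cantorInterval_snoc_subset (hA : 1 ≤ A) (w : Fin n → Bool) (b : Bool) :
    cantorInterval A (n + 1) (Fin.snoc w b) ⊆ cantorInterval A n w := by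
  have hle := inv_pow_succ_le hA n
  rintro t ⟨hl, hr⟩
  rw [cantorLeft_snoc] at hl hr
  cases b <;> simp only [Bool.false_eq_true, if_true, if_false] at hl hr <;>
    constructor <;> linarith

lemma cantorGap_eq_sdiff (hA : 0 ≤ A) (w : Fin n → Bool) :
    cantorGap A n w =
      cantorInterval A n w \ ⋃ b, cantorInterval A (n + 1) (Fin.snoc w b) := by
  have hpos : 0 ≤ A⁻¹ ^ (n + 1) := by positivity
  ext t
  simp only [cantorGap, cantorInterval, cantorLeft_snoc, mem_sdiff, mem_iUnion, Bool.exists_bool,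
    mem_Ioo, mem_Icc, Bool.false_eq_true, if_true, if_false]
  grind

lemma cantorLevel_zero (A : ℝ) : cantorLevel A 0 = Icc 0 1 := by
  simp [cantorLevel, cantorInterval, cantorLeft, iUnion_const]

lemma cantorLevel_succ (A : ℝ) (n : ℕ) :
    cantorLevel A (n + 1) = ⋃ (w) (b), cantorInterval A (n + 1) (Fin.snoc w b) := by
  rw [cantorLevel, ← (Fin.snocEquiv fun _ => Bool).surjective.iUnion_comp, iUnion_comm]
  exact iSup_prod

lemma antitone_cantorLevel (hA : 1 ≤ A) : Antitone (cantorLevel A) := by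
  refine antitone_nat_of_succ_le fun n => ?_
  rw [cantorLevel_succ]
  exact iUnion_mono fun w => iUnion_subset fun b => cantorInterval_snoc_subset hA w b

lemma cantorLevel_subset_Icc (hA : 1 ≤ A) (n : ℕ) : cantorLevel A n ⊆ Icc 0 1 :=
  cantorLevel_zero A ▸ antitone_cantorLevel hA n.zero_le

lemma cantorInterval_subset_Icc (hA : 1 ≤ A) (w : Fin n → Bool) :
    cantorInterval A n w ⊆ Icc 0 1 :=
  (subset_iUnion _ w).trans (cantorLevel_subset_Icc hA n)

lemma cantorAngles_subset_Icc (A : ℝ) : cantorAngles A ⊆ Icc 0 1 :=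
  cantorLevel_zero A ▸ iInter_subset _ 0

lemma pairwise_disjoint_cantorInterval (hA : 2 < A) (n : ℕ) :
    Pairwise (Function.onFun Disjoint (cantorInterval A n)) := by
  induction n with
  | zero => exact fun w w' hne => absurd (Subsingleton.elim w w') hne
  | succ n ih =>
    intro w w' hne
    induction w using Fin.snocCases with | _ v b
    induction w' using Fin.snocCases with | _ v' b'
    have hA1 : 1 ≤ A := by linarith
    by_cases hv : v = v'
    · subst hv
      have hlt := two_mul_inv_pow_succ_lt hA n
      refine disjoint_left.2 fun t ht ht' => hne ?_
      simp only [cantorInterval, cantorLeft_snoc, mem_Icc] at ht ht'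
      cases b <;> cases b' <;> first
        | rfl
        | (simp only [Bool.false_eq_true, if_true, if_false] at ht ht'; linarith)
    · exact (ih hv).mono (cantorInterval_snoc_subset hA1 v b) (cantorInterval_snoc_subset hA1 v' b')

lemma iUnion_cantorGap (hA : 2 < A) (n : ℕ) :
    ⋃ w, cantorGap A n w = cantorLevel A n \ cantorLevel A (n + 1) := by
  have hA1 : 1 ≤ A := by linarith
  have hother : ∀ w w' b, w' ≠ w →
      Disjoint (cantorInterval A n w) (cantorInterval A (n + 1) (Fin.snoc w' b)) :=
    fun w w' b hne => (pairwise_disjoint_cantorInterval hA n hne.symm).mono_right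
      (cantorInterval_snoc_subset hA1 w' b)
  rw [cantorLevel, iUnion_sdiff, cantorLevel_succ]
  refine iUnion_congr fun w => ?_
  rw [cantorGap_eq_sdiff (by linarith)]
  refine Subset.antisymm (fun t ht => ⟨ht.1, fun hmem => ?_⟩)
    (sdiff_subset_sdiff_right (subset_iUnion
      (fun v => ⋃ b, cantorInterval A (n + 1) (Fin.snoc v b)) w))
  obtain ⟨w', hw'⟩ := mem_iUnion.1 hmem
  obtain ⟨b, hb⟩ := mem_iUnion.1 hw'
  by_cases hne : w' = w
  · exact ht.2 (hne ▸ hw')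
  · exact disjoint_left.1 (hother w w' b hne) ht.1 hb

lemma cantorGap_subset_cantorInterval (hA : 0 ≤ A) (w : Fin n → Bool) :
    cantorGap A n w ⊆ cantorInterval A n w :=
  cantorGap_eq_sdiff hA w ▸ sdiff_subset

lemma pairwise_disjoint_cantorGap (hA : 2 < A) :
    Pairwise (Function.onFun Disjoint fun i : Σ n, Fin n → Bool => cantorGap A i.1 i.2) := by
  have hA0 : 0 ≤ A := by linarith
  rintro ⟨m, v⟩ ⟨n, w⟩ hne
  by_cases hmn : m = n
  · subst hmn
    exact (pairwise_disjoint_cantorInterval hA m fun h => hne (by rw [h])).mono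
      (cantorGap_subset_cantorInterval hA0 v) (cantorGap_subset_cantorInterval hA0 w)
  · have hgap : ∀ k u, cantorGap A k u ⊆ cantorLevel A k \ cantorLevel A (k + 1) :=
      fun k u => iUnion_cantorGap hA k ▸ subset_iUnion (cantorGap A k) u
    exact (pairwise_disjoint_sdiff_succ (antitone_cantorLevel (by linarith)) hmn).mono
      (hgap m v) (hgap n w)

lemma Icc_sdiff_cantorAngles (hA : 2 < A) :
    Icc 0 1 \ cantorAngles A = ⋃ i : Σ n, Fin n → Bool, cantorGap A i.1 i.2 := by
  rw [← cantorLevel_zero A, cantorAngles,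
    sdiff_iInter_eq_iUnion_sdiff_succ (antitone_cantorLevel (by linarith)), iUnion_sigma]
  exact iUnion_congr fun n => (iUnion_cantorGap hA n).symm

lemma volume_cantorInterval (A : ℝ) (w : Fin n → Bool) :
    volume (cantorInterval A n w) = ENNReal.ofReal (A⁻¹ ^ n) := by
  rw [cantorInterval, Real.volume_Icc, add_sub_cancel_left]

lemma volume_cantorGap (A : ℝ) (w : Fin n → Bool) :
    volume (cantorGap A n w) = ENNReal.ofReal (A⁻¹ ^ n * (1 - 2 * A⁻¹)) := by
  rw [cantorGap, Real.volume_Ioo]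
  ring_nf

lemma volume_cantorAngles (hA : 2 < A) : volume (cantorAngles A) = 0 := by
  have hratio : 2 * ENNReal.ofReal A⁻¹ < 1 := by
    rw [← ENNReal.ofReal_ofNat, ← ENNReal.ofReal_mul (by norm_num), ENNReal.ofReal_lt_one]
    simpa using two_mul_inv_pow_succ_lt hA 0
  refine le_antisymm (ge_of_tendsto'
    (ENNReal.tendsto_pow_atTop_nhds_zero_of_lt_one hratio) fun n => ?_) zero_le
  calc volume (cantorAngles A) ≤ volume (cantorLevel A n) := measure_mono (iInter_subset _ n)
    _ ≤ ∑' w : Fin n → Bool, volume (cantorInterval A n w) := measure_iUnion_le _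
    _ = (2 * ENNReal.ofReal A⁻¹) ^ n := by
      have hinv : 0 ≤ A⁻¹ := by positivity
      simp only [volume_cantorInterval, tsum_fintype, Finset.sum_const, Finset.card_univ,
        Fintype.card_pi_const, Fintype.card_bool, nsmul_eq_mul, mul_pow, ENNReal.ofReal_pow hinv,
        Nat.cast_pow, Nat.cast_ofNat]

end CantorIntervals

/-! ### The circle and arc length -/

section Circle

lemma circleExp_injOn_Ico : InjOn Circle.exp (Ico 0 (2 * π)) :=
  Circle.exp_injOn_Ico (by simp)

lemma Icc_zero_one_subset_Ico : Icc (0 : ℝ) 1 ⊆ Ico 0 (2 * π) :=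
  Icc_subset_Ico_right (by linarith [Real.pi_gt_three])

lemma circleExp_injOn_Icc : InjOn Circle.exp (Icc 0 1) :=
  circleExp_injOn_Ico.mono Icc_zero_one_subset_Ico

lemma circleExp_image_Ico : Circle.exp '' Ico 0 (2 * π) = univ := by
  refine eq_univ_of_forall fun z => ?_
  obtain ⟨s, rfl⟩ := Circle.exp_surjective z
  obtain ⟨t, ht, hst⟩ := Circle.periodic_exp.exists_mem_Ico₀ Real.two_pi_pos s
  exact ⟨t, ht, hst.symm⟩

lemma isOpen_circleExp_image {s : Set ℝ} (hs : IsOpen s) : IsOpen (Circle.exp '' s) :=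
  isLocalHomeomorph_circleExp.isOpenMap s hs

lemma dist_circle_eq_norm_sub (ζ z : Circle) : dist ζ z = ‖(ζ : ℂ) - z‖ :=
  dist_eq_norm (ζ : ℂ) z

lemma dist_circleExp_le (s t : ℝ) : dist (Circle.exp s) (Circle.exp t) ≤ dist s t := by
  have hmul : Circle.exp s = Circle.exp t * Circle.exp (s - t) := by
    rw [← Circle.exp_add, add_sub_cancel]
  have hfactor : (Circle.exp s : ℂ) - Circle.exp t =
      Circle.exp t * (Complex.exp (Complex.I * ↑(s - t)) - 1) := by
    rw [hmul, Circle.coe_mul, Circle.coe_exp (s - t), mul_comm Complex.I, mul_sub, mul_one]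
  rw [dist_circle_eq_norm_sub, hfactor, norm_mul, Circle.norm_coe, one_mul, Real.dist_eq]
  exact Real.norm_exp_I_mul_ofReal_sub_one_le

instance isFiniteMeasure_arcLength : IsFiniteMeasure arcLength := by
  unfold arcLength
  infer_instance

lemma arcLength_image_circleExp {s : Set ℝ} (hs : MeasurableSet s) (hsub : s ⊆ Ioc (-π) π) :
    arcLength (Circle.exp '' s) = volume s := by
  have hinj : InjOn Circle.exp (Ioc (-π) π) := Circle.exp_injOn_Ioc (by linarith)
  have hmeas : MeasurableSet (Circle.exp '' s) :=
    hs.image_of_continuousOn_injOn Circle.exp.continuous.continuousOn (hinj.mono hsub)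
  rw [arcLength, Measure.map_apply Circle.exp.continuous.measurable hmeas,
    Measure.restrict_apply (Circle.exp.continuous.measurable hmeas),
    hinj.preimage_image_inter hsub]

end Circle

/-! ### The Cantor measure -/

section CantorMeasure

variable {A : ℝ} {n : ℕ}

lemma circleCantorSet_eq_image (hA : 1 ≤ A) :
    circleCantorSet A = Circle.exp '' cantorAngles A := by
  simp only [circleCantorSet, cantorArc_eq_image, ← image_iUnion]
  exact (InjOn.image_iInter_eq (circleExp_injOn_Icc.mono
    (iUnion_subset fun n => cantorLevel_subset_Icc hA n))).symm

lemma isCompact_cantorArc (A : ℝ) (n : ℕ) (w : Fin n → Bool) : IsCompact (cantorArc A n w) :=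
  isCompact_Icc.image Circle.exp.continuous

lemma isClosed_circleCantorSet (A : ℝ) : IsClosed (circleCantorSet A) :=
  isClosed_iInter fun _ => isClosed_iUnion_of_finite fun _ =>
    (isCompact_cantorArc A _ _).isClosed

/-- The point of the Cantor set of angles whose intervals have the addresses
`x 0, …, x (n - 1)`. -/
def cantorPoint (A : ℝ) (x : ℕ → Bool) : ℝ :=
  ∑' k, if x k then A⁻¹ ^ k - A⁻¹ ^ (k + 1) else 0

lemma norm_cantorPoint_term_le (hA : 1 ≤ A) (b : Bool) (k : ℕ) :
    ‖if b then A⁻¹ ^ k - A⁻¹ ^ (k + 1) else 0‖ ≤ A⁻¹ ^ k := by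
  have hle := inv_pow_succ_le hA k
  have hpos : ∀ m, 0 ≤ A⁻¹ ^ m := fun m => by positivity
  cases b
  · simpa using hpos k
  · rw [if_pos rfl, Real.norm_of_nonneg (by linarith)]
    linarith [hpos (k + 1)]

lemma summable_inv_pow (hA : 1 < A) : Summable fun k : ℕ => A⁻¹ ^ k :=
  summable_geometric_of_lt_one (by positivity) (inv_lt_one_of_one_lt₀ hA)

lemma continuous_cantorPoint (hA : 1 < A) : Continuous (cantorPoint A) :=
  continuous_tsum
    (fun k => (continuous_of_discreteTopology
      (f := fun b : Bool => if b then A⁻¹ ^ k - A⁻¹ ^ (k + 1) else 0)).comp (continuous_apply k))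
    (summable_inv_pow hA) fun k x => norm_cantorPoint_term_le hA.le (x k) k

lemma tendsto_cantorLeft_cantorPoint (hA : 1 < A) (x : ℕ → Bool) :
    Filter.Tendsto (fun n => cantorLeft A n (x ∘ Fin.val)) Filter.atTop (𝓝 (cantorPoint A x)) := by
  have hsum := Summable.of_norm_bounded (summable_inv_pow hA)
    fun k => norm_cantorPoint_term_le hA.le (x k) k
  simpa only [cantorPoint, cantorLeft, Function.comp_apply, Fin.sum_univ_eq_sum_range
    fun k => if x k then A⁻¹ ^ k - A⁻¹ ^ (k + 1) else 0] using hsum.hasSum.tendsto_sum_nat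

lemma antitone_cantorInterval_prefix (hA : 1 ≤ A) (x : ℕ → Bool) :
    Antitone fun n => cantorInterval A n (x ∘ Fin.val) := by
  refine antitone_nat_of_succ_le fun n => ?_
  have hsnoc : (x ∘ Fin.val : Fin (n + 1) → Bool) = Fin.snoc (x ∘ Fin.val) (x n) := by
    rw [← Fin.snoc_init_self (x ∘ Fin.val : Fin (n + 1) → Bool)]
    rfl
  rw [hsnoc]
  exact cantorInterval_snoc_subset hA _ _

lemma cantorPoint_mem_cantorInterval (hA : 1 < A) (x : ℕ → Bool) (n : ℕ) :
    cantorPoint A x ∈ cantorInterval A n (x ∘ Fin.val) := by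
  refine isClosed_Icc.mem_of_tendsto (tendsto_cantorLeft_cantorPoint hA x)
    (Filter.eventually_atTop.2 ⟨n, fun m hm => antitone_cantorInterval_prefix hA.le x hm ?_⟩)
  exact left_mem_Icc.2 (le_add_of_nonneg_right (by positivity))

lemma cantorPoint_mem_cantorAngles (hA : 1 < A) (x : ℕ → Bool) :
    cantorPoint A x ∈ cantorAngles A :=
  mem_iInter.2 fun n => mem_iUnion.2 ⟨_, cantorPoint_mem_cantorInterval hA x n⟩

lemma circleExp_cantorPoint_mem_cantorArc_iff (hA : 2 < A) {x : ℕ → Bool} {w : Fin n → Bool} :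
    Circle.exp (cantorPoint A x) ∈ cantorArc A n w ↔ x ∘ Fin.val = w := by
  have hA1 : 1 < A := by linarith
  have hmem := cantorPoint_mem_cantorInterval hA1 x n
  rw [cantorArc_eq_image, circleExp_injOn_Icc.mem_image_iff (cantorInterval_subset_Icc hA1.le w)
    (cantorInterval_subset_Icc hA1.le _ hmem)]
  refine ⟨fun hw => ?_, fun hw => hw ▸ hmem⟩
  by_contra hne
  exact disjoint_left.1 (pairwise_disjoint_cantorInterval hA n hne) hmem hw

/-- The law of an infinite sequence of independent fair coin tosses. -/
def fairCoinTosses : Measure (ℕ → Bool) :=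
  Measure.infinitePi fun _ => (PMF.uniformOfFintype Bool).toMeasure

instance isProbabilityMeasure_fairCoinTosses : IsProbabilityMeasure fairCoinTosses := by
  unfold fairCoinTosses
  infer_instance

lemma fairCoinTosses_cylinder (x : ℕ → Bool) (n : ℕ) :
    fairCoinTosses (PiNat.cylinder x n) = 2⁻¹ ^ n := by
  rw [fairCoinTosses, PiNat.cylinder_eq_pi,
    Measure.infinitePi_pi _ fun _ _ => measurableSet_singleton _]
  simp

/-- The Cantor measure with parameter `A`, as the image of fair coin tosses under the coding of
the Cantor set by addresses. -/
def cantorMeasure (A : ℝ) : Measure Circle :=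
  fairCoinTosses.map fun x => Circle.exp (cantorPoint A x)

theorem isCantorMeasure_cantorMeasure (hA : 2 < A) : IsCantorMeasure A (cantorMeasure A) := by
  have hA1 : 1 < A := by linarith
  have hmeas : Measurable fun x => Circle.exp (cantorPoint A x) :=
    (Circle.exp.continuous.comp (continuous_cantorPoint hA1)).measurable
  refine ⟨Measure.isProbabilityMeasure_map hmeas.aemeasurable, ?_, fun n w => ?_⟩
  · have hpre : (fun x => Circle.exp (cantorPoint A x)) ⁻¹' (circleCantorSet A)ᶜ = ∅ := by
      rw [circleCantorSet_eq_image hA1.le]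
      exact eq_empty_of_forall_notMem fun x hx =>
        hx (mem_image_of_mem _ (cantorPoint_mem_cantorAngles hA1 x))
    rw [cantorMeasure,
      Measure.map_apply hmeas (isClosed_circleCantorSet A).isOpen_compl.measurableSet, hpre,
      measure_empty]
  · obtain ⟨x, rfl⟩ := Fin.val_injective.surjective_comp_right (γ := Bool) w
    have hpre : (fun y => Circle.exp (cantorPoint A y)) ⁻¹' cantorArc A n (x ∘ Fin.val) =
        PiNat.cylinder x n := by
      ext y
      simp only [mem_preimage, circleExp_cantorPoint_mem_cantorArc_iff hA, funext_iff,
        Function.comp_apply, Fin.forall_iff, PiNat.mem_cylinder_iff]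
    rw [cantorMeasure, Measure.map_apply hmeas (isCompact_cantorArc A n _).measurableSet, hpre,
      fairCoinTosses_cylinder]

end CantorMeasure

/-! ### Complementary arcs of the Cantor set -/

section ComplementaryArcs

lemma connectedComponentIn_iUnion {X ι : Type*} [TopologicalSpace X] {U : ι → Set X} {i : ι}
    {x : X} (hopen : ∀ i, IsOpen (U i)) (hconn : ∀ i, IsPreconnected (U i))
    (hdisj : Pairwise (Function.onFun Disjoint U)) (hx : x ∈ U i) :
    connectedComponentIn (⋃ j, U j) x = U i := by
  have hxU : x ∈ ⋃ j, U j := mem_iUnion_of_mem i hx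
  refine Subset.antisymm ?_ ((hconn i).subset_connectedComponentIn hx (subset_iUnion U i))
  refine isPreconnected_connectedComponentIn.subset_left_of_subset_union (hopen i)
    (v := ⋃ (j) (_ : j ≠ i), U j) (isOpen_biUnion fun j _ => hopen j) ?_ ?_
    ⟨x, mem_connectedComponentIn hxU, hx⟩
  · exact disjoint_iUnion₂_right.2 fun j hj => hdisj hj.symm
  · refine (connectedComponentIn_subset _ _).trans (iUnion_subset fun j => ?_)
    by_cases hj : j = i
    · exact hj ▸ subset_union_left
    · exact (subset_iUnion₂ (s := fun j _ => U j) j hj).trans subset_union_right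

lemma tsum_range_le {α ι : Type*} (U : ι → α) (f : α → ℝ≥0∞) :
    ∑' J : range U, f J ≤ ∑' i, f (U i) :=
  calc ∑' J : range U, f J = ∑' J : range U, f (U (rangeSplitting U J)) := by
        simp only [apply_rangeSplitting]
    _ ≤ ∑' i, f (U i) :=
        ENNReal.tsum_comp_le_tsum_of_injective (rangeSplitting_injective U) fun i => f (U i)

lemma tsum_complementaryArcs_le {ι : Type*} {E : Set Circle} {U : ι → Set Circle}
    (hopen : ∀ i, IsOpen (U i)) (hconn : ∀ i, IsPreconnected (U i))
    (hdisj : Pairwise (Function.onFun Disjoint U)) (hE : Eᶜ = ⋃ i, U i) (f : Set Circle → ℝ≥0∞) :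
    ∑' J : complementaryArcs E, f J ≤ ∑' i, f (U i) := by
  have hsub : complementaryArcs E ⊆ range U := by
    rintro _ ⟨z, hz, rfl⟩
    obtain ⟨i, hi⟩ := mem_iUnion.1 (hE ▸ hz)
    exact ⟨i, by rw [hE, connectedComponentIn_iUnion hopen hconn hdisj hi]⟩
  exact (ENNReal.tsum_mono_subtype f hsub).trans (tsum_range_le U f)

variable {A : ℝ} {n : ℕ}

/-- The open intervals of angles in `[0, 2π)` complementary to the Cantor set: the outer interval
`(1, 2π)`, indexed by `Unit`, and the gaps of all generations. -/
def cantorComplementInterval (A : ℝ) : Unit ⊕ (Σ n, Fin n → Bool) → Set ℝ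
  | .inl _ => Ioo 1 (2 * π)
  | .inr i => cantorGap A i.1 i.2

lemma isOpen_cantorComplementInterval (A : ℝ) (i : Unit ⊕ (Σ n, Fin n → Bool)) :
    IsOpen (cantorComplementInterval A i) := by
  cases i <;> exact isOpen_Ioo

lemma isPreconnected_cantorComplementInterval (A : ℝ) (i : Unit ⊕ (Σ n, Fin n → Bool)) :
    IsPreconnected (cantorComplementInterval A i) := by
  cases i <;> exact isPreconnected_Ioo

lemma cantorGap_subset_Icc (hA : 1 ≤ A) (w : Fin n → Bool) : cantorGap A n w ⊆ Icc 0 1 :=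
  (cantorGap_subset_cantorInterval (by linarith) w).trans (cantorInterval_subset_Icc hA w)

lemma pairwise_disjoint_cantorComplementInterval (hA : 2 < A) :
    Pairwise (Function.onFun Disjoint (cantorComplementInterval A)) := by
  have houter : ∀ i : Σ n, Fin n → Bool, Disjoint (Ioo 1 (2 * π)) (cantorGap A i.1 i.2) :=
    fun i => disjoint_left.2 fun t ht ht' =>
      ht.1.not_ge (cantorGap_subset_Icc (by linarith) i.2 ht').2
  rintro (_ | i) (_ | j) hij
  · exact absurd rfl hij
  · exact houter j
  · exact (houter i).symm
  · exact pairwise_disjoint_cantorGap hA fun h => hij (congrArg Sum.inr h)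

lemma iUnion_cantorComplementInterval (hA : 2 < A) :
    ⋃ i, cantorComplementInterval A i = Ico 0 (2 * π) \ cantorAngles A := by
  have houter : Ico 0 (2 * π) \ Icc 0 1 = Ioo 1 (2 * π) := by
    ext t
    simp only [mem_sdiff, mem_Ico, mem_Icc, mem_Ioo]
    grind
  rw [← sdiff_union_sdiff_cancel Icc_zero_one_subset_Ico (cantorAngles_subset_Icc A), houter,
    Icc_sdiff_cantorAngles hA, iUnion_sum]
  simp only [cantorComplementInterval, iUnion_const]

lemma compl_circleCantorSet (hA : 2 < A) :
    (circleCantorSet A)ᶜ = ⋃ i, Circle.exp '' cantorComplementInterval A i := by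
  rw [circleCantorSet_eq_image (by linarith), ← image_iUnion, iUnion_cantorComplementInterval hA,
    circleExp_injOn_Ico.image_sdiff, circleExp_image_Ico, inter_eq_right.2
      ((cantorAngles_subset_Icc A).trans Icc_zero_one_subset_Ico), compl_eq_univ_sdiff]

lemma pairwise_disjoint_circleExp_image_cantorComplementInterval (hA : 2 < A) :
    Pairwise (Function.onFun Disjoint fun i => Circle.exp '' cantorComplementInterval A i) := by
  have hsub : ∀ i, cantorComplementInterval A i ⊆ Ico 0 (2 * π) := fun i =>
    (subset_iUnion _ i).trans ((iUnion_cantorComplementInterval hA).trans_subset sdiff_subset)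
  exact fun i j hij =>
    (pairwise_disjoint_cantorComplementInterval hA hij).image
      circleExp_injOn_Ico (hsub i) (hsub j)

lemma Icc_zero_one_subset_Ioc : Icc (0 : ℝ) 1 ⊆ Ioc (-π) π := fun t ht =>
  ⟨by linarith [ht.1, Real.pi_pos], by linarith [ht.2, Real.pi_gt_three]⟩

lemma arcLength_cantorGap (hA : 1 ≤ A) (w : Fin n → Bool) :
    arcLength (Circle.exp '' cantorGap A n w) = ENNReal.ofReal (A⁻¹ ^ n * (1 - 2 * A⁻¹)) := by
  rw [arcLength_image_circleExp (by exact measurableSet_Ioo)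
    ((cantorGap_subset_Icc hA w).trans Icc_zero_one_subset_Ioc), volume_cantorGap]

lemma arcLength_circleCantorSet (hA : 2 < A) : arcLength (circleCantorSet A) = 0 := by
  have hmeas : MeasurableSet (cantorAngles A) :=
    .iInter fun _ => .iUnion fun _ => measurableSet_Icc
  rw [circleCantorSet_eq_image (by linarith), arcLength_image_circleExp hmeas
    ((cantorAngles_subset_Icc A).trans Icc_zero_one_subset_Ioc), volume_cantorAngles hA]

lemma pos_of_one_lt_rpow {α : ℝ} (hA : 1 ≤ A) (hα : 1 < A ^ α) : 0 < α := by
  by_contra! hneg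
  exact hα.not_ge (Real.rpow_le_one_of_one_le_of_nonpos hA hneg)

lemma tsum_arcLength_cantorGap_rpow_lt_top {α : ℝ} (hA : 1 < A) (hα : 2 < A ^ α) :
    ∑' i : Σ n, Fin n → Bool, arcLength (Circle.exp '' cantorGap A i.1 i.2) ^ α < ∞ := by
  have hA0 : 0 < A := by linarith
  have hα0 : 0 < α := pos_of_one_lt_rpow hA.le (by linarith)
  have hratio : 2 * ENNReal.ofReal (A⁻¹ ^ α) < 1 := by
    rw [← ENNReal.ofReal_ofNat, ← ENNReal.ofReal_mul (by norm_num), ENNReal.ofReal_lt_one,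
      Real.inv_rpow hA0.le, ← div_eq_mul_inv, div_lt_one (by positivity)]
    exact hα
  have hgap : ∀ n (w : Fin n → Bool),
      arcLength (Circle.exp '' cantorGap A n w) ^ α ≤ ENNReal.ofReal (A⁻¹ ^ α) ^ n := fun n w => by
    rw [arcLength_cantorGap hA.le, ← ENNReal.ofReal_pow (by positivity),
      Real.rpow_pow_comm (by positivity), ← ENNReal.ofReal_rpow_of_nonneg (by positivity) hα0.le]
    gcongr
    exact mul_le_of_le_one_right (by positivity) (by linarith [inv_pos.2 hA0])
  calc ∑' i : Σ n, Fin n → Bool, arcLength (Circle.exp '' cantorGap A i.1 i.2) ^ α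
      ≤ ∑' (n : ℕ) (_ : Fin n → Bool), ENNReal.ofReal (A⁻¹ ^ α) ^ n := by
        rw [ENNReal.tsum_sigma']
        exact ENNReal.tsum_le_tsum fun n => ENNReal.tsum_le_tsum (hgap n)
    _ = ∑' n : ℕ, (2 * ENNReal.ofReal (A⁻¹ ^ α)) ^ n := by simp [mul_pow]
    _ < ∞ := tsum_geometric_lt_top.2 hratio

theorem isBeurlingCarleson_circleCantorSet {α : ℝ} (hA : 2 < A) (hα : 2 < A ^ α) :
    IsBeurlingCarleson α (circleCantorSet A) := by
  refine ⟨isClosed_circleCantorSet A, arcLength_circleCantorSet hA, ?_⟩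
  have hA1 : 1 < A := by linarith
  have hα0 : 0 < α := pos_of_one_lt_rpow hA1.le (by linarith)
  calc ∑' J : complementaryArcs (circleCantorSet A), arcLength (J : Set Circle) ^ α
      ≤ ∑' i, arcLength (Circle.exp '' cantorComplementInterval A i) ^ α :=
        tsum_complementaryArcs_le
          (fun i => isOpen_circleExp_image (isOpen_cantorComplementInterval A i))
          (fun i => (isPreconnected_cantorComplementInterval A i).image _
            Circle.exp.continuous.continuousOn)
          (pairwise_disjoint_circleExp_image_cantorComplementInterval hA)
          (compl_circleCantorSet hA) fun J => arcLength J ^ α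
    _ = arcLength (Circle.exp '' Ioo 1 (2 * π)) ^ α +
          ∑' i : Σ n, Fin n → Bool, arcLength (Circle.exp '' cantorGap A i.1 i.2) ^ α := by
        rw [Summable.tsum_sum ENNReal.summable ENNReal.summable]
        simp [cantorComplementInterval]
    _ < ∞ := ENNReal.add_lt_top.2
        ⟨ENNReal.rpow_lt_top_of_nonneg hα0.le (measure_ne_top _ _),
          tsum_arcLength_cantorGap_rpow_lt_top hA1 hα⟩

end ComplementaryArcs

/-! ### Boundary derivative of a singular inner function -/

theorem hasDerivAt_setIntegral_of_continuousOn {X 𝕜 V : Type*} [TopologicalSpace X]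
    [MeasurableSpace X] [OpensMeasurableSpace X] [RCLike 𝕜] [NormedAddCommGroup V]
    [NormedSpace ℝ V] [NormedSpace 𝕜 V] {ν : Measure X} [IsFiniteMeasureOnCompacts ν]
    {K : Set X} (hK : IsCompact K) (hKm : MeasurableSet K) {U : Set 𝕜} (hU : IsOpen U)
    {F F' : 𝕜 → X → V} (hF : ∀ x ∈ U, ContinuousOn (F x) K)
    (hF' : ContinuousOn (Function.uncurry F') (U ×ˢ K))
    (hderiv : ∀ x ∈ U, ∀ ζ ∈ K, HasDerivAt (F · ζ) (F' x ζ) x) {z : 𝕜} (hz : z ∈ U) :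
    HasDerivAt (fun x => ∫ ζ in K, F x ζ ∂ν) (∫ ζ in K, F' z ζ ∂ν) z := by
  obtain ⟨r, hr, hrU⟩ := Metric.nhds_basis_closedBall.mem_iff.1 (hU.mem_nhds hz)
  obtain ⟨C, hC⟩ := ((isCompact_closedBall z r).prod hK).exists_bound_of_continuousOn
    (hF'.mono (prod_mono_left hrU))
  have hcont : ∀ x ∈ U, ContinuousOn (F' x) K := fun x hx =>
    hF'.comp (f := fun ζ => (x, ζ)) (by fun_prop) fun ζ hζ => ⟨hx, hζ⟩
  refine (hasDerivAt_integral_of_dominated_loc_of_deriv_le (bound := fun _ => C)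
    (Metric.closedBall_mem_nhds z hr) ?_ ((hF z hz).integrableOn_compact' hK hKm)
    ((hcont z hz).aestronglyMeasurable_of_isCompact hK hKm) ?_
    (integrableOn_const hK.measure_ne_top) ?_).2
  · filter_upwards [hU.mem_nhds hz] with x hx
    exact (hF x hx).aestronglyMeasurable_of_isCompact hK hKm
  · filter_upwards [ae_restrict_mem hKm] with ζ hζ x hx using hC (x, ζ) ⟨hx, hζ⟩
  · filter_upwards [ae_restrict_mem hKm] with ζ hζ x hx using hderiv x (hrU hx) ζ hζ

lemma two_mul_div_sub_sq_eq (ζ z : Circle) :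
    2 * (ζ : ℂ) / ((ζ : ℂ) - z) ^ 2 = -(z : ℂ)⁻¹ * ((2 / ‖(ζ : ℂ) - z‖ ^ 2 : ℝ) : ℂ) := by
  rcases eq_or_ne ζ z with rfl | hne
  · simp
  have hsub : (ζ : ℂ) - z ≠ 0 := sub_ne_zero.2 (Circle.coe_injective.ne hne)
  have hζ := ζ.coe_ne_zero
  have hz := z.coe_ne_zero
  have hnorm : ((‖(ζ : ℂ) - z‖ ^ 2 : ℝ) : ℂ) = -(((ζ : ℂ) - z) ^ 2 / (ζ * z)) := by
    rw [← Complex.normSq_eq_norm_sq, ← Complex.mul_conj, map_sub, ← Circle.coe_inv_eq_conj,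
      ← Circle.coe_inv_eq_conj, Circle.coe_inv, Circle.coe_inv]
    field_simp
    ring
  rw [Complex.ofReal_div, hnorm, Complex.ofReal_ofNat]
  field_simp

lemma conj_add_div_sub (ζ z : Circle) :
    (starRingEnd ℂ) (((ζ : ℂ) + z) / ((ζ : ℂ) - z)) = -(((ζ : ℂ) + z) / ((ζ : ℂ) - z)) := by
  have hζ := ζ.coe_ne_zero
  have hz := z.coe_ne_zero
  rw [map_div₀, map_add, map_sub, ← Circle.coe_inv_eq_conj, ← Circle.coe_inv_eq_conj,
    Circle.coe_inv, Circle.coe_inv, inv_add_inv hζ hz, inv_sub_inv hζ hz,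
    div_div_div_cancel_right₀ (mul_ne_zero hζ hz), ← div_neg, neg_sub]

lemma norm_singularInner_circle (ν : Measure Circle) (z : Circle) :
    ‖singularInner ν z‖ = 1 := by
  have hconj : (starRingEnd ℂ) (∫ ζ : Circle, ((ζ : ℂ) + z) / ((ζ : ℂ) - z) ∂ν) =
      -∫ ζ : Circle, ((ζ : ℂ) + z) / ((ζ : ℂ) - z) ∂ν := by
    rw [← integral_conj, ← integral_neg]
    simp only [conj_add_div_sub]
  have hre := congrArg Complex.re hconj
  rw [Complex.conj_re, Complex.neg_re] at hre
  rw [singularInner, Complex.norm_exp, Complex.neg_re, Real.exp_eq_one_iff]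
  linarith

section SupportedOnClosed

variable {ν : Measure Circle} [IsFiniteMeasure ν] {E : Set Circle}

lemma isOpen_compl_coe_image (hE : IsClosed E) : IsOpen (((↑) : Circle → ℂ) '' E)ᶜ :=
  (hE.isCompact.image (by fun_prop)).isClosed.isOpen_compl

theorem hasDerivAt_singularInner (hE : IsClosed E) (hν : ν Eᶜ = 0) {z : ℂ}
    (hz : z ∉ ((↑) : Circle → ℂ) '' E) :
    HasDerivAt (singularInner ν)
      (singularInner ν z * -∫ ζ : Circle, 2 * (ζ : ℂ) / ((ζ : ℂ) - z) ^ 2 ∂ν) z := by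
  have hsub : ∀ x ∈ (((↑) : Circle → ℂ) '' E)ᶜ, ∀ ζ ∈ E, (ζ : ℂ) - x ≠ 0 := fun x hx ζ hζ h =>
    hx ⟨ζ, hζ, sub_eq_zero.1 h⟩
  have hderiv : HasDerivAt (fun x => ∫ ζ in E, ((ζ : ℂ) + x) / ((ζ : ℂ) - x) ∂ν)
      (∫ ζ in E, 2 * (ζ : ℂ) / ((ζ : ℂ) - z) ^ 2 ∂ν) z := by
    refine hasDerivAt_setIntegral_of_continuousOn (F' := fun x ζ => 2 * (ζ : ℂ) / (ζ - x) ^ 2)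
      hE.isCompact hE.measurableSet (isOpen_compl_coe_image hE)
      (fun x hx => ContinuousOn.div (by fun_prop) (by fun_prop) (hsub x hx))
      (ContinuousOn.div (by fun_prop) (by fun_prop)
        fun y hy => pow_ne_zero 2 (hsub y.1 hy.1 y.2 hy.2))
      (fun x hx ζ hζ => ?_) hz
    refine (((hasDerivAt_id x).const_add (ζ : ℂ)).div ((hasDerivAt_id x).const_sub (ζ : ℂ))
      (hsub x hx ζ hζ)).congr_deriv ?_
    simp only [id]
    ring
  rw [Measure.restrict_eq_self_of_ae_mem (mem_ae_iff.2 hν)] at hderiv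
  exact hderiv.neg.cexp

lemma coe_notMem_coe_image {z : Circle} (hz : z ∉ E) : (z : ℂ) ∉ ((↑) : Circle → ℂ) '' E :=
  Circle.coe_injective.mem_set_image.not.2 hz

lemma continuousAt_deriv_singularInner (hE : IsClosed E) (hν : ν Eᶜ = 0) {z : Circle}
    (hz : z ∉ E) : ContinuousAt (deriv (singularInner ν)) z := by
  have hdiff : DifferentiableOn ℂ (singularInner ν) (((↑) : Circle → ℂ) '' E)ᶜ := fun x hx =>
    (hasDerivAt_singularInner hE hν hx).differentiableAt.differentiableWithinAt
  have hopen := isOpen_compl_coe_image hE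
  exact ((hdiff.deriv hopen).differentiableAt
    (hopen.mem_nhds (coe_notMem_coe_image hz))).continuousAt

theorem enorm_deriv_singularInner (hE : IsClosed E) (hν : ν Eᶜ = 0) {z : Circle} (hz : z ∉ E) :
    ‖deriv (singularInner ν) z‖ₑ = ∫⁻ ζ, 2 / edist ζ z ^ 2 ∂ν := by
  have hpos : ∀ ζ ∈ E, 0 < ‖(ζ : ℂ) - z‖ := fun ζ hζ =>
    norm_pos_iff.2 (sub_ne_zero.2 fun h => hz (Circle.ext h ▸ hζ))
  have hint : Integrable (fun ζ : Circle => 2 / ‖(ζ : ℂ) - z‖ ^ 2) ν := by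
    rw [← Measure.restrict_eq_self_of_ae_mem (mem_ae_iff.2 hν : ∀ᵐ ζ ∂ν, ζ ∈ E)]
    exact ContinuousOn.integrableOn_compact hE.isCompact
      (ContinuousOn.div (by fun_prop) (by fun_prop) fun ζ hζ => (pow_pos (hpos ζ hζ) 2).ne')
  calc ‖deriv (singularInner ν) z‖ₑ
      = ‖∫ ζ : Circle, 2 * (ζ : ℂ) / ((ζ : ℂ) - z) ^ 2 ∂ν‖ₑ := by
        rw [(hasDerivAt_singularInner hE hν (coe_notMem_coe_image hz)).deriv, enorm_mul,
          ← ofReal_norm (singularInner ν z), norm_singularInner_circle, ENNReal.ofReal_one, one_mul,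
          enorm_neg]
    _ = ‖((∫ ζ : Circle, 2 / ‖(ζ : ℂ) - z‖ ^ 2 ∂ν : ℝ) : ℂ)‖ₑ := by
        simp only [two_mul_div_sub_sq_eq]
        rw [integral_const_mul, enorm_mul, enorm_neg, ← ofReal_norm (z : ℂ)⁻¹, norm_inv,
          Circle.norm_coe, inv_one, ENNReal.ofReal_one, one_mul, integral_complex_ofReal]
    _ = ∫⁻ ζ : Circle, ENNReal.ofReal (2 / ‖(ζ : ℂ) - z‖ ^ 2) ∂ν := by
        rw [← ofReal_norm, Complex.norm_real, Real.norm_of_nonneg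
          (integral_nonneg fun ζ => by positivity), ofReal_integral_eq_lintegral_ofReal hint
          (Filter.Eventually.of_forall fun ζ => by positivity)]
    _ = ∫⁻ ζ, 2 / edist ζ z ^ 2 ∂ν := by
        refine lintegral_congr_ae ?_
        filter_upwards [(mem_ae_iff.2 hν : ∀ᵐ ζ ∂ν, ζ ∈ E)] with ζ hζ
        rw [ENNReal.ofReal_div_of_pos (pow_pos (hpos ζ hζ) 2),
          ENNReal.ofReal_pow (norm_nonneg _), ENNReal.ofReal_ofNat, ← dist_circle_eq_norm_sub,
          ← edist_dist]

lemma mul_measure_closedEBall_le_enorm_deriv_singularInner (hE : IsClosed E) (hν : ν Eᶜ = 0)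
    {z : Circle} (hz : z ∉ E) (d : ℝ≥0∞) :
    2 / d ^ 2 * ν (Metric.closedEBall z d) ≤ ‖deriv (singularInner ν) z‖ₑ := by
  rw [enorm_deriv_singularInner hE hν hz]
  calc 2 / d ^ 2 * ν (Metric.closedEBall z d)
      = ∫⁻ _ in Metric.closedEBall z d, 2 / d ^ 2 ∂ν := (setLIntegral_const _ _).symm
    _ ≤ ∫⁻ ζ in Metric.closedEBall z d, 2 / edist ζ z ^ 2 ∂ν := by
        refine setLIntegral_mono' Metric.isClosed_closedEBall.measurableSet fun ζ hζ => ?_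
        rw [Metric.mem_closedEBall] at hζ
        gcongr
    _ ≤ ∫⁻ ζ, 2 / edist ζ z ^ 2 ∂ν := setLIntegral_le_lintegral _ _

end SupportedOnClosed

/-! ### Boundary integrals and the Hardy space -/

lemma MemHardy.setLIntegral_enorm_rpow_lt_top {p : ℝ} {f : ℂ → ℂ} (hf : MemHardy p f)
    {G : Set Circle} (hG : MeasurableSet G) (hcont : ∀ z ∈ G, ContinuousAt f (z : ℂ)) :
    ∫⁻ z in G, ‖f z‖ₑ ^ p ∂arcLength < ∞ := by
  obtain ⟨hdiff, C, hC⟩ := hf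
  obtain ⟨r, -, hr, hr1⟩ := exists_seq_strictMono_tendsto' (zero_lt_one (α := ℝ))
  have hGm : MeasurableSet (Circle.exp ⁻¹' G) := Circle.exp.continuous.measurable hG
  have hmeas : ∀ n, Measurable fun t : ℝ => ‖f (circleMap 0 (r n) t)‖ₑ ^ p := fun n => by
    have hmem : ∀ t, circleMap 0 (r n) t ∈ Metric.ball (0 : ℂ) 1 := fun t => by
      rw [mem_ball_zero_iff, norm_circleMap_zero, abs_of_pos (hr n).1]
      exact (hr n).2
    exact ((hdiff.continuousOn.comp_continuous (by fun_prop) hmem).enorm.measurable).pow_const p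
  have hlim : ∀ t ∈ Circle.exp ⁻¹' G, Filter.Tendsto
      (fun n => ‖f (circleMap 0 (r n) t)‖ₑ ^ p) Filter.atTop (𝓝 (‖f (Circle.exp t)‖ₑ ^ p)) := by
    intro t ht
    have hradial : Filter.Tendsto (fun n => circleMap 0 (r n) t) Filter.atTop
        (𝓝 (Circle.exp t : ℂ)) := by
      simpa only [circleMap_zero, Circle.coe_exp, Complex.ofReal_one, one_mul,
        Function.comp_def] using
        ((Complex.continuous_ofReal.tendsto 1).comp hr1).mul_const (Complex.exp (t * Complex.I))
    exact (ENNReal.continuous_rpow_const.tendsto _).comp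
      (((hcont _ ht).tendsto.comp hradial).enorm)
  calc ∫⁻ z in G, ‖f z‖ₑ ^ p ∂arcLength
      ≤ ∫⁻ t in Circle.exp ⁻¹' G, ‖f (Circle.exp t)‖ₑ ^ p ∂volume.restrict (Ioc (-π) π) := by
        rw [arcLength, Measure.restrict_map Circle.exp.continuous.measurable hG]
        exact lintegral_map_le _ _
    _ = ∫⁻ t in Circle.exp ⁻¹' G, Filter.liminf
          (fun n => ‖f (circleMap 0 (r n) t)‖ₑ ^ p) Filter.atTop ∂volume.restrict (Ioc (-π) π) :=
        setLIntegral_congr_fun hGm fun t ht => (hlim t ht).liminf_eq.symm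
    _ ≤ Filter.liminf (fun n => ∫⁻ t in Circle.exp ⁻¹' G, ‖f (circleMap 0 (r n) t)‖ₑ ^ p
          ∂volume.restrict (Ioc (-π) π)) Filter.atTop := lintegral_liminf_le hmeas
    _ ≤ Filter.liminf (fun _ : ℕ => (C : ℝ≥0∞)) Filter.atTop :=
        Filter.liminf_le_liminf (Filter.Eventually.of_forall fun n =>
          (setLIntegral_le_lintegral _ _).trans (hC _ ⟨(hr n).1.le, (hr n).2⟩))
    _ = C := Filter.liminf_const _
    _ < ∞ := ENNReal.coe_lt_top

/-! ### Divergence over the gaps -/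

lemma sum_le_rpow_mul_sum_rpow {ι : Type*} {s : Finset ι} {x : ι → ℝ≥0∞} {a : ℝ≥0∞}
    (hx : ∀ i ∈ s, x i ≤ a) {p : ℝ} (hp0 : 0 ≤ p) (hp1 : p ≤ 1) :
    ∑ i ∈ s, x i ≤ a ^ (1 - p) * ∑ i ∈ s, x i ^ p := by
  rw [Finset.mul_sum]
  refine Finset.sum_le_sum fun i hi => ?_
  calc x i = x i ^ (1 - p) * x i ^ p := by
        rw [← ENNReal.rpow_add_of_nonneg _ _ (sub_nonneg.2 hp1) hp0, sub_add_cancel,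
          ENNReal.rpow_one]
    _ ≤ a ^ (1 - p) * x i ^ p := by
        gcongr
        exact hx i hi

section Divergence

variable {A p : ℝ} {n : ℕ}

lemma half_pow_rpow_le (hA : 0 < A) (hp : 0 ≤ p) (hAp : A ^ (1 - 2 * p) ≤ 2 ^ (1 - p)) (n : ℕ) :
    ((2⁻¹ : ℝ) ^ n) ^ (1 - p) ≤ A⁻¹ ^ n * (2 / (A⁻¹ ^ n) ^ 2) ^ p := by
  have hlen : 0 < A⁻¹ ^ n := by positivity
  calc ((2⁻¹ : ℝ) ^ n) ^ (1 - p) = ((2 ^ (1 - p))⁻¹) ^ n := by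
        rw [← Real.rpow_pow_comm (by norm_num), Real.inv_rpow zero_le_two]
    _ ≤ ((A ^ (1 - 2 * p))⁻¹) ^ n := by gcongr
    _ = (A⁻¹ ^ n) ^ (1 - 2 * p) := by
        rw [← Real.rpow_pow_comm (by positivity), Real.inv_rpow hA.le]
    _ ≤ 2 ^ p * (A⁻¹ ^ n) ^ (1 - 2 * p) :=
        le_mul_of_one_le_left (by positivity) (Real.one_le_rpow one_le_two hp)
    _ = A⁻¹ ^ n * (2 / (A⁻¹ ^ n) ^ 2) ^ p := by
        rw [Real.rpow_sub hlen, Real.rpow_one, Real.rpow_mul hlen.le, Real.rpow_two,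
          Real.div_rpow zero_le_two (by positivity)]
        ring

lemma cantorArc_subset_closedEBall {w : Fin n → Bool} {t : ℝ} (ht : t ∈ cantorInterval A n w) :
    cantorArc A n w ⊆ Metric.closedEBall (Circle.exp t) (ENNReal.ofReal (A⁻¹ ^ n)) := by
  rintro _ ⟨s, hs, rfl⟩
  rw [Metric.mem_closedEBall, edist_dist]
  refine ENNReal.ofReal_le_ofReal ((dist_circleExp_le s t).trans ?_)
  simpa only [add_sub_cancel_left] using Real.dist_le_of_mem_Icc hs ht

variable {ν : Measure Circle}

lemma measure_univ_le_sum_cantorArc (hν : ν (circleCantorSet A)ᶜ = 0) (n : ℕ) :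
    ν univ ≤ ∑ w : Fin n → Bool, ν (cantorArc A n w) := by
  rw [← measure_of_measure_compl_eq_zero hν]
  exact (measure_mono (iInter_subset _ n)).trans (measure_iUnion_fintype_le _ _)

lemma measure_univ_le_sum_rpow (hA : 0 < A) (hp0 : 0 ≤ p) (hp1 : p ≤ 1)
    (hAp : A ^ (1 - 2 * p) ≤ 2 ^ (1 - p)) (hν : ν (circleCantorSet A)ᶜ = 0)
    (hmass : ∀ w : Fin n → Bool, ν (cantorArc A n w) ≤ 2⁻¹ ^ n) :
    ν univ ≤ ENNReal.ofReal (A⁻¹ ^ n) *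
      ∑ w, (2 / ENNReal.ofReal (A⁻¹ ^ n) ^ 2 * ν (cantorArc A n w)) ^ p := by
  have hlen : 0 < A⁻¹ ^ n := by positivity
  have hscale : ((2⁻¹ : ℝ≥0∞) ^ n) ^ (1 - p) ≤
      ENNReal.ofReal (A⁻¹ ^ n) * (2 / ENNReal.ofReal (A⁻¹ ^ n) ^ 2) ^ p := by
    have h := ENNReal.ofReal_le_ofReal (half_pow_rpow_le hA hp0 hAp n)
    rwa [← ENNReal.ofReal_rpow_of_nonneg (by positivity) (sub_nonneg.2 hp1),
      ENNReal.ofReal_mul hlen.le, ← ENNReal.ofReal_rpow_of_nonneg (by positivity) hp0,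
      ENNReal.ofReal_div_of_pos (by positivity), ENNReal.ofReal_pow hlen.le,
      ENNReal.ofReal_pow (by norm_num), ENNReal.ofReal_inv_of_pos two_pos,
      ENNReal.ofReal_ofNat] at h
  calc ν univ ≤ ∑ w : Fin n → Bool, ν (cantorArc A n w) := measure_univ_le_sum_cantorArc hν n
    _ ≤ ((2⁻¹ : ℝ≥0∞) ^ n) ^ (1 - p) * ∑ w : Fin n → Bool, ν (cantorArc A n w) ^ p :=
        sum_le_rpow_mul_sum_rpow (fun w _ => hmass w) hp0 hp1
    _ ≤ ENNReal.ofReal (A⁻¹ ^ n) * (2 / ENNReal.ofReal (A⁻¹ ^ n) ^ 2) ^ p *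
          ∑ w : Fin n → Bool, ν (cantorArc A n w) ^ p := by gcongr
    _ = _ := by
        simp only [ENNReal.mul_rpow_of_nonneg _ _ hp0]
        rw [← Finset.mul_sum, mul_assoc]

variable [IsFiniteMeasure ν]

lemma mul_rpow_le_setLIntegral_cantorGap (hA : 2 < A) (hp : 0 ≤ p)
    (hν : ν (circleCantorSet A)ᶜ = 0) (w : Fin n → Bool) :
    ENNReal.ofReal (1 - 2 * A⁻¹) * (ENNReal.ofReal (A⁻¹ ^ n) *
        (2 / ENNReal.ofReal (A⁻¹ ^ n) ^ 2 * ν (cantorArc A n w)) ^ p) ≤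
      ∫⁻ z in Circle.exp '' cantorGap A n w, ‖deriv (singularInner ν) z‖ₑ ^ p ∂arcLength := by
  have hA0 : 0 ≤ A := by linarith
  have hmeas : MeasurableSet (Circle.exp '' cantorGap A n w) :=
    (isOpen_circleExp_image isOpen_Ioo).measurableSet
  have hlower : ∀ z ∈ Circle.exp '' cantorGap A n w,
      (2 / ENNReal.ofReal (A⁻¹ ^ n) ^ 2 * ν (cantorArc A n w)) ^ p ≤
        ‖deriv (singularInner ν) z‖ₑ ^ p := by
    rintro _ ⟨t, ht, rfl⟩
    have hoff : Circle.exp t ∉ circleCantorSet A := by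
      rw [← mem_compl_iff, compl_circleCantorSet hA]
      exact mem_iUnion.2 ⟨.inr ⟨n, w⟩, mem_image_of_mem _ ht⟩
    gcongr
    calc 2 / ENNReal.ofReal (A⁻¹ ^ n) ^ 2 * ν (cantorArc A n w)
        ≤ 2 / ENNReal.ofReal (A⁻¹ ^ n) ^ 2 *
            ν (Metric.closedEBall (Circle.exp t) (ENNReal.ofReal (A⁻¹ ^ n))) := by
          gcongr
          exact cantorArc_subset_closedEBall (cantorGap_subset_cantorInterval hA0 w ht)
      _ ≤ ‖deriv (singularInner ν) (Circle.exp t)‖ₑ :=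
          mul_measure_closedEBall_le_enorm_deriv_singularInner (isClosed_circleCantorSet A) hν
            hoff _
  refine le_trans (le_of_eq ?_) (setLIntegral_mono' hmeas hlower)
  rw [setLIntegral_const, arcLength_cantorGap (by linarith), ENNReal.ofReal_mul (by positivity)]
  ring

theorem lintegral_enorm_deriv_singularInner_rpow_eq_top (hA : 2 < A) (hp0 : 0 ≤ p) (hp1 : p ≤ 1)
    (hAp : A ^ (1 - 2 * p) ≤ 2 ^ (1 - p)) (hν : ν (circleCantorSet A)ᶜ = 0) (hν0 : ν ≠ 0)
    (hmass : ∀ (n : ℕ) (w : Fin n → Bool), ν (cantorArc A n w) ≤ 2⁻¹ ^ n) :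
    ∫⁻ z in (circleCantorSet A)ᶜ, ‖deriv (singularInner ν) z‖ₑ ^ p ∂arcLength = ∞ := by
  have hA0 : 0 < A := by linarith
  have hratio : ENNReal.ofReal (1 - 2 * A⁻¹) ≠ 0 := by
    rw [← div_eq_mul_inv, ne_eq, ENNReal.ofReal_eq_zero, not_le, sub_pos, div_lt_one hA0]
    exact hA
  have hmeas : ∀ i, MeasurableSet (Circle.exp '' cantorComplementInterval A i) := fun i =>
    (isOpen_circleExp_image (isOpen_cantorComplementInterval A i)).measurableSet
  refine top_le_iff.1 ?_
  calc ∞ = ∑' _ : ℕ, ENNReal.ofReal (1 - 2 * A⁻¹) * ν univ :=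
        (ENNReal.tsum_const_eq_top_of_ne_zero
          (mul_ne_zero hratio (Measure.measure_univ_ne_zero.2 hν0))).symm
    _ ≤ ∑' (n : ℕ) (w : Fin n → Bool), ∫⁻ z in Circle.exp '' cantorGap A n w,
          ‖deriv (singularInner ν) z‖ₑ ^ p ∂arcLength := by
        refine ENNReal.tsum_le_tsum fun n => ?_
        grw [measure_univ_le_sum_rpow hA0 hp0 hp1 hAp hν (hmass n), tsum_fintype, Finset.mul_sum,
          Finset.mul_sum]
        exact Finset.sum_le_sum fun w _ => mul_rpow_le_setLIntegral_cantorGap hA hp0 hν w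
    _ ≤ ∑' i, ∫⁻ z in Circle.exp '' cantorComplementInterval A i,
          ‖deriv (singularInner ν) z‖ₑ ^ p ∂arcLength := by
        rw [← ENNReal.tsum_sigma' fun i : Σ n, Fin n → Bool =>
          ∫⁻ z in Circle.exp '' cantorGap A i.1 i.2, ‖deriv (singularInner ν) z‖ₑ ^ p ∂arcLength]
        exact ENNReal.tsum_comp_le_tsum_of_injective Sum.inr_injective _
    _ = ∫⁻ z in (circleCantorSet A)ᶜ, ‖deriv (singularInner ν) z‖ₑ ^ p ∂arcLength := by
        rw [compl_circleCantorSet hA, lintegral_iUnion hmeas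
          (pairwise_disjoint_circleExp_image_cantorComplementInterval hA)]

theorem not_derivMemHardy_of_measure_cantorArc_le (hA : 2 < A) (hp0 : 0 ≤ p) (hp1 : p ≤ 1)
    (hAp : A ^ (1 - 2 * p) ≤ 2 ^ (1 - p)) (hν : ν (circleCantorSet A)ᶜ = 0) (hν0 : ν ≠ 0)
    (hmass : ∀ (n : ℕ) (w : Fin n → Bool), ν (cantorArc A n w) ≤ 2⁻¹ ^ n) :
    ¬DerivMemHardy p ν := fun hHardy =>
  have hE := isClosed_circleCantorSet A
  (hHardy.setLIntegral_enorm_rpow_lt_top hE.isOpen_compl.measurableSet fun _ hz =>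
    continuousAt_deriv_singularInner hE hν hz).ne
    (lintegral_enorm_deriv_singularInner_rpow_eq_top hA hp0 hp1 hAp hν hν0 hmass)

end Divergence

/-! ### The critical ratio -/

section CriticalRatio

variable {p : ℝ}

/-- The scale of the Cantor set for which `2⁻ⁿ`, the mass of an arc of length `ℓ = A⁻ⁿ`, satisfies
`(2⁻ⁿ) ^ (1 - p) = ℓ ^ (1 - 2 * p)`: this is `A ^ (1 - 2 * p) = 2 ^ (1 - p)` solved for `A`. -/
def criticalRatio (p : ℝ) : ℝ := 2 ^ ((1 - p) / (1 - 2 * p))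

lemma criticalRatio_rpow (p α : ℝ) :
    criticalRatio p ^ α = 2 ^ ((1 - p) / (1 - 2 * p) * α) :=
  (Real.rpow_mul zero_le_two _ _).symm

lemma criticalRatio_rpow_one_sub_two_mul (hp : p ≠ 1 / 2) :
    criticalRatio p ^ (1 - 2 * p) = 2 ^ (1 - p) := by
  have hp' : 1 - 2 * p ≠ 0 := fun h => hp (by linarith)
  rw [criticalRatio_rpow, div_mul_cancel₀ _ hp']

lemma two_lt_criticalRatio_rpow (hp : p < 1 / 2) {q : ℝ} (hq : q < p / (1 - p)) :
    2 < criticalRatio p ^ (1 - q) := by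
  rw [criticalRatio_rpow, div_mul_eq_mul_div]
  refine Real.self_lt_rpow_of_one_lt one_lt_two ?_
  rw [one_lt_div (by linarith)]
  linarith [(lt_div_iff₀ (by linarith : 0 < 1 - p)).1 hq]

lemma two_lt_criticalRatio (hp0 : 0 < p) (hp : p < 1 / 2) : 2 < criticalRatio p := by
  simpa only [sub_zero, Real.rpow_one] using
    two_lt_criticalRatio_rpow hp (div_pos hp0 (by linarith : 0 < 1 - p))

theorem not_derivMemHardy_of_le_isCantorMeasure (hp0 : 0 < p) (hp : p < 1 / 2)
    {μ ν : Measure Circle} (hμ : IsCantorMeasure (criticalRatio p) μ) (hν0 : ν ≠ 0) (hle : ν ≤ μ) :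
    ¬DerivMemHardy p ν := by
  obtain ⟨hprob, hsupp, hmass⟩ := hμ
  have := isFiniteMeasure_of_le μ hle
  exact not_derivMemHardy_of_measure_cantorArc_le (two_lt_criticalRatio hp0 hp) hp0.le
    (by linarith) (criticalRatio_rpow_one_sub_two_mul hp.ne).le
    (Measure.absolutelyContinuous_of_le hle hsupp) hν0 fun n w => (hle _).trans (hmass n w).le

end CriticalRatio

lemma not_upToCountableSums {P : Measure Circle → Prop} {μ : Measure Circle} (hμ : μ ≠ 0)
    (hP : ∀ ν, ν ≠ 0 → ν ≤ μ → ¬P ν) : ¬UpToCountableSums P μ := by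
  rintro ⟨m, hm, rfl⟩
  obtain ⟨k, hk⟩ : ∃ k, m k ≠ 0 := by
    by_contra! hzero
    exact hμ (Measure.sum_eq_zero.2 hzero)
  exact hP (m k) hk (Measure.le_sum m k) (hm k).2

lemma IsBeurlingCarleson.concentratedOnBeurlingCarleson {α : ℝ} {E : Set Circle}
    (hE : IsBeurlingCarleson α E) {μ : Measure Circle} (hμ : μ Eᶜ = 0) :
    ConcentratedOnBeurlingCarleson α μ :=
  ⟨fun _ => E, fun _ => hE, by rwa [iUnion_const]⟩

lemma IsBeurlingCarleson.mutuallySingular_arcLength {α : ℝ} {E : Set Circle}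
    (hE : IsBeurlingCarleson α E) {μ : Measure Circle} (hμ : μ Eᶜ = 0) : μ ⟂ₘ arcLength :=
  .symm ⟨E, hE.1.measurableSet, hE.2.1, hμ⟩

end

theorem mainTheorem11 (p : ℝ) (hp0 : 0 < p) (hp : p < 1 / 2) :
    (∀ q : ℝ, q < p / (1 - p) →
      ∃ (A : ℝ) (μ : Measure Circle), 2 < A ∧
        IsBeurlingCarleson (1 - q) (circleCantorSet A) ∧ IsCantorMeasure A μ ∧
        ∀ ν : Measure Circle, ν ≠ 0 → ν ≤ μ → ¬ DerivMemHardy p ν) ∧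
    (∃ μ : Measure Circle, IsFiniteMeasure μ ∧ μ ⟂ₘ arcLength ∧
      ConcentratedOnBeurlingCarleson (1 - p) μ ∧
      ¬ UpToCountableSums (DerivMemHardy p) μ) ∧
    (∀ q : ℝ,
      (∀ (E : Set Circle) (μ : Measure Circle), IsFiniteMeasure μ →
        IsBeurlingCarleson (1 - q) E → μ Eᶜ = 0 → DerivMemHardy p μ) →
      p / (1 - p) ≤ q) := by
  have hA : 2 < criticalRatio p := two_lt_criticalRatio hp0 hp
  have hμ : IsCantorMeasure (criticalRatio p) (cantorMeasure (criticalRatio p)) :=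
    isCantorMeasure_cantorMeasure hA
  have ⟨hprob, hsupp, _⟩ := hμ
  have hμ0 := IsProbabilityMeasure.ne_zero (cantorMeasure (criticalRatio p))
  have hBC (q : ℝ) (hq : q < p / (1 - p)) :
      IsBeurlingCarleson (1 - q) (circleCantorSet (criticalRatio p)) :=
    isBeurlingCarleson_circleCantorSet hA (two_lt_criticalRatio_rpow hp hq)
  have hHardy (ν : Measure Circle) (hν0 : ν ≠ 0) (hle : ν ≤ cantorMeasure (criticalRatio p)) :
      ¬DerivMemHardy p ν := not_derivMemHardy_of_le_isCantorMeasure hp0 hp hμ hν0 hle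
  have hpq : p < p / (1 - p) := by rw [lt_div_iff₀] <;> nlinarith
  refine ⟨fun q hq => ⟨_, _, hA, hBC q hq, hμ, hHardy⟩,
    ⟨_, inferInstance, (hBC p hpq).mutuallySingular_arcLength hsupp,
      (hBC p hpq).concentratedOnBeurlingCarleson hsupp, not_upToCountableSums hμ0 hHardy⟩,
    fun q h => ?_⟩
  by_contra! hq
  exact hHardy _ hμ0 le_rfl (h _ _ inferInstance (hBC q hq) hsupp)
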